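/- An additive closed symmetric monoidal structure on a preadditive category $\mathcal C$ is a symmetric monoidal structure on $\mathcal C$ (product $\wedge$, unit, associativity, unit and symmetry isomorphisms satisfying the usual coherence conditions) such that $\wedge$ is additive in each variable and every functor $X\wedge -$ has a right adjoint. Two such structures $S$ and $T$ on $\mathcal C$ are equivalent if there is an additive strong symmetric monoidal functor $(\mathcal C,S)\to(\mathcal C,T)$ whose underlying functor is an equivalence of categories. Let $n$ be an integer. The category of $\mathbb{Z}/n\mathbb{Z}$-modules (for $n=0$, the category of abelian groups) admits an additive closed symmetric monoidal structure, and any two additive closed symmetric monoidal structures on it are equivalent. -/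

import Mathlib

open CategoryTheory

universe v u

/-- An additive closed symmetric monoidal structure on a preadditive category `C`: a symmetric
monoidal structure whose product is additive in each variable and such that every functor
`X ⊗ -` has a right adjoint. The underlying category `C` is fixed; the product, the unit and all
coherence isomorphisms are part of the data. -/
structure AdditiveClosedSymmetricMonoidalStructure
    (C : Type u) [Category.{v} C] [Preadditive C] where
  /-- the product, the unit, the associator and the unitors -/
  monoidal : MonoidalCategory C
  /-- the symmetry -/
  symmetric : SymmetricCategory C
  /-- the product is additive in each variable -/
  additive : MonoidalPreadditive C
  /-- the internal hom functors, right adjoint to `X ⊗ -` -/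
  closed : MonoidalClosed C

namespace AdditiveClosedSymmetricMonoidalStructure

variable {C : Type u} [Category.{v} C] [Preadditive C]

/-- A symmetric monoidal functor `(C, S) ⥤ (C, T)` with underlying functor `F`: invertible
comparison maps `T.unit ≅ F S.unit` and `F X ⊗_T F Y ≅ F (X ⊗_S Y)`, the latter natural,
compatible with the associators, the unitors and the symmetries. -/
abbrev SymmetricMonoidalFunctorStructure
    (S T : AdditiveClosedSymmetricMonoidalStructure C) (F : C ⥤ C) :=
  @Functor.Braided C _ S.monoidal S.symmetric.toBraidedCategory
    C _ T.monoidal T.symmetric.toBraidedCategory F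

/-- `S` and `T` are equivalent if there is an additive symmetric monoidal functor from `(C, S)` to
`(C, T)` whose underlying functor is an equivalence of categories. -/
def Equivalent (S T : AdditiveClosedSymmetricMonoidalStructure C) : Prop :=
  ∃ F : C ⥤ C, F.IsEquivalence ∧ F.Additive ∧
    Nonempty (SymmetricMonoidalFunctorStructure S T F)

end AdditiveClosedSymmetricMonoidalStructure

/-! Write `R` for the quotient of `ℤ`, so additive maps of `R`-modules are linear. In any structure
with product `∧`, the functor `R ∧ -` is an additive left adjoint, so by Eilenberg–Watts `I ⊗[R] (R
∧ R) ≅ R ∧ I ≅ R` for the unit `I`. Thus `I` is invertible, and free of rank one because the Picard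
group of `R` is trivial (`nonempty_unit_iso_rankOne`).

Morphisms are then the additive maps on elements `I ⟶ X`. By closedness, morphisms out of `X ∧ Y`
are the biadditive maps on elements (`IsAdditivelyDense.exists_tensor_hom`,
`IsAdditivelyDense.tensor_hom_ext`). This universal property fixes `∧`: an isomorphism of units
makes the identity functor strong symmetric monoidal, and all coherences are checked on pure tensors
(`braidedOfUnitIso`). -/

open MonoidalCategory

noncomputable section

/-! ### Elements, pure tensors and the universal property of the product -/

section Pure

variable {C : Type*} [Category* C]

/-- `U` is additively dense if morphisms `X ⟶ Y` are the same as additive maps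
`(U ⟶ X) →+ (U ⟶ Y)`. -/
structure IsAdditivelyDense [Preadditive C] (U : C) : Prop where
  hom_ext {X Y : C} {f g : X ⟶ Y} (h : ∀ x : U ⟶ X, x ≫ f = x ≫ g) : f = g
  exists_hom {X Y : C} (φ : (U ⟶ X) →+ (U ⟶ Y)) : ∃ f : X ⟶ Y, ∀ x : U ⟶ X, x ≫ f = φ x

variable [MonoidalCategory C]

/-- The element `x ⊗ y` of `X ⊗ Y` determined by elements `x` of `X` and `y` of `Y`. -/
def pureTensor {X Y : C} (x : 𝟙_ C ⟶ X) (y : 𝟙_ C ⟶ Y) : 𝟙_ C ⟶ X ⊗ Y :=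
  (λ_ (𝟙_ C)).inv ≫ (x ⊗ₘ y)

lemma pureTensor_eq_comp_whiskerLeft {X Y : C} (x : 𝟙_ C ⟶ X) (y : 𝟙_ C ⟶ Y) :
    pureTensor x y = x ≫ (ρ_ X).inv ≫ X ◁ y := by
  rw [pureTensor, MonoidalCategory.tensorHom_def, unitors_inv_equal,
    ← rightUnitor_inv_naturality_assoc]

lemma pureTensor_eq_comp_whiskerRight {X Y : C} (x : 𝟙_ C ⟶ X) (y : 𝟙_ C ⟶ Y) :
    pureTensor x y = y ≫ (λ_ Y).inv ≫ x ▷ Y := by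
  rw [pureTensor, MonoidalCategory.tensorHom_def', ← leftUnitor_inv_naturality_assoc]

lemma pureTensor_comp_whiskerRight {X X' Y : C} (x : 𝟙_ C ⟶ X) (y : 𝟙_ C ⟶ Y) (f : X ⟶ X') :
    pureTensor x y ≫ f ▷ Y = pureTensor (x ≫ f) y := by
  simp [pureTensor_eq_comp_whiskerRight]

lemma pureTensor_comp_whiskerLeft {X Y Y' : C} (x : 𝟙_ C ⟶ X) (y : 𝟙_ C ⟶ Y) (f : Y ⟶ Y') :
    pureTensor x y ≫ X ◁ f = pureTensor x (y ≫ f) := by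
  simp [pureTensor_eq_comp_whiskerLeft]

lemma pureTensor_comp_associator {X Y Z : C} (x : 𝟙_ C ⟶ X) (y : 𝟙_ C ⟶ Y) (z : 𝟙_ C ⟶ Z) :
    pureTensor (pureTensor x y) z ≫ (α_ X Y Z).hom = pureTensor x (pureTensor y z) := by
  simp [pureTensor_eq_comp_whiskerLeft]

lemma pureTensor_comp_leftUnitor {Y : C} (a : 𝟙_ C ⟶ 𝟙_ C) (y : 𝟙_ C ⟶ Y) :
    pureTensor a y ≫ (λ_ Y).hom = a ≫ y := by
  simp [pureTensor_eq_comp_whiskerLeft, unitors_equal]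

lemma pureTensor_comp_rightUnitor {X : C} (x : 𝟙_ C ⟶ X) (a : 𝟙_ C ⟶ 𝟙_ C) :
    pureTensor x a ≫ (ρ_ X).hom = a ≫ x := by
  simp [pureTensor_eq_comp_whiskerRight, ← unitors_equal]

lemma pureTensor_comp_braiding [BraidedCategory C] {X Y : C} (x : 𝟙_ C ⟶ X) (y : 𝟙_ C ⟶ Y) :
    pureTensor x y ≫ (β_ X Y).hom = pureTensor y x := by
  simp [pureTensor, unitors_inv_equal]

section Additive

variable [Preadditive C] [MonoidalPreadditive C]

lemma pureTensor_add_left {X Y : C} (x x' : 𝟙_ C ⟶ X) (y : 𝟙_ C ⟶ Y) :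
    pureTensor (x + x') y = pureTensor x y + pureTensor x' y := by
  simp [pureTensor, MonoidalPreadditive.add_tensor]

lemma pureTensor_add_right {X Y : C} (x : 𝟙_ C ⟶ X) (y y' : 𝟙_ C ⟶ Y) :
    pureTensor x (y + y') = pureTensor x y + pureTensor x y' := by
  simp [pureTensor, MonoidalPreadditive.tensor_add]

end Additive

variable [Preadditive C] [MonoidalClosed C]

/-- Currying turns both maps into morphisms out of `Y`, which elements of `Y` separate. -/
lemma IsAdditivelyDense.tensor_hom_ext_right {U : C} (hU : IsAdditivelyDense U) {X Y Z : C}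
    {f g : X ⊗ Y ⟶ Z} (h : ∀ y : U ⟶ Y, X ◁ y ≫ f = X ◁ y ≫ g) : f = g := by
  refine MonoidalClosed.curry_injective (hU.hom_ext fun y ↦ ?_)
  rw [← MonoidalClosed.curry_natural_left, ← MonoidalClosed.curry_natural_left, h]

lemma IsAdditivelyDense.tensor_hom_ext (hU : IsAdditivelyDense (𝟙_ C)) {X Y Z : C}
    {f g : X ⊗ Y ⟶ Z} (h : ∀ x y, pureTensor x y ≫ f = pureTensor x y ≫ g) : f = g := by
  refine hU.tensor_hom_ext_right fun y ↦ ?_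
  rw [← cancel_epi (ρ_ X).inv]
  refine hU.hom_ext fun x ↦ ?_
  simpa [pureTensor_eq_comp_whiskerLeft] using h x y

lemma IsAdditivelyDense.tensor_hom_ext₃ (hU : IsAdditivelyDense (𝟙_ C)) {X Y Z W : C}
    {f g : (X ⊗ Y) ⊗ Z ⟶ W}
    (h : ∀ x y z, pureTensor (pureTensor x y) z ≫ f = pureTensor (pureTensor x y) z ≫ g) :
    f = g := by
  refine hU.tensor_hom_ext_right fun z ↦ ?_
  rw [← cancel_epi (ρ_ _).inv]
  refine hU.tensor_hom_ext fun x y ↦ ?_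
  simpa [pureTensor_eq_comp_whiskerLeft (pureTensor x y)] using h x y z

variable [MonoidalPreadditive C]

lemma MonoidalClosed.curry_add {X Y Z : C} (f g : X ⊗ Y ⟶ Z) :
    MonoidalClosed.curry (f + g) = MonoidalClosed.curry f + MonoidalClosed.curry g := by
  apply MonoidalClosed.uncurry_injective
  simp [MonoidalClosed.uncurry_eq (_ + _), Preadditive.add_comp, ← MonoidalClosed.uncurry_eq]

/-- Biadditive maps on elements extend to morphisms out of the product. -/
lemma IsAdditivelyDense.exists_tensor_hom (hU : IsAdditivelyDense (𝟙_ C)) {X Y Z : C}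
    (b : (𝟙_ C ⟶ Y) →+ (𝟙_ C ⟶ X) →+ (𝟙_ C ⟶ Z)) :
    ∃ f : X ⊗ Y ⟶ Z, ∀ x y, pureTensor x y ≫ f = b y x := by
  choose k hk using fun y ↦ hU.exists_hom (b y)
  -- Each `k y : X ⟶ Z` is an element of the internal hom; density applied once more, in `y`,
  -- assembles these into a morphism out of `Y`.
  let φ : (𝟙_ C ⟶ Y) →+ (𝟙_ C ⟶ (ihom X).obj Z) :=
    AddMonoidHom.mk' (fun y ↦ MonoidalClosed.curry ((ρ_ X).hom ≫ k y)) fun y y' ↦ by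
      rw [← MonoidalClosed.curry_add, ← Preadditive.comp_add]
      congr 2
      refine hU.hom_ext fun x ↦ ?_
      simp [hk]
  obtain ⟨g, hg⟩ := hU.exists_hom φ
  refine ⟨MonoidalClosed.uncurry g, fun x y ↦ ?_⟩
  rw [pureTensor_eq_comp_whiskerLeft, Category.assoc, Category.assoc,
    ← MonoidalClosed.uncurry_natural_left, hg]
  simp [φ, hk]

end Pure

/-! ### Strong monoidality of an equivalence preserving units -/

section Compare

variable {C D : Type*} [Category* C] [Preadditive C] [MonoidalCategory C]
  [Category* D] [Preadditive D] [MonoidalCategory D]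

variable (F : C ⥤ D) [F.IsEquivalence] [F.Additive] (ε : 𝟙_ D ≅ F.obj (𝟙_ C))

/-- The bijection between elements of `X` and elements of `F X`. -/
def elementEquiv (X : C) : (𝟙_ C ⟶ X) ≃+ (𝟙_ D ⟶ F.obj X) where
  toFun x := ε.hom ≫ F.map x
  invFun y := F.preimage (ε.inv ≫ y)
  left_inv x := by simp
  right_inv y := by simp
  map_add' x x' := by simp

variable {F} in
lemma elementEquiv_comp_map {X Y : C} (x : 𝟙_ C ⟶ X) (f : X ⟶ Y) :
    elementEquiv F ε X x ≫ F.map f = elementEquiv F ε Y (x ≫ f) := by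
  simp [elementEquiv]

variable [MonoidalPreadditive C] [MonoidalClosed C] [MonoidalPreadditive D] [MonoidalClosed D]
  (hC : IsAdditivelyDense (𝟙_ C)) (hD : IsAdditivelyDense (𝟙_ D))

omit [MonoidalClosed C] in
include hD in
lemma exists_tensorComparison (X Y : C) : ∃ μ : F.obj X ⊗ F.obj Y ⟶ F.obj (X ⊗ Y),
    ∀ x y, pureTensor (elementEquiv F ε X x) (elementEquiv F ε Y y) ≫ μ =
      elementEquiv F ε _ (pureTensor x y) := by
  let b : (𝟙_ D ⟶ F.obj Y) →+ (𝟙_ D ⟶ F.obj X) →+ (𝟙_ D ⟶ F.obj (X ⊗ Y)) :=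
    AddMonoidHom.mk' (fun y ↦ AddMonoidHom.mk' (fun x ↦ elementEquiv F ε _
      (pureTensor ((elementEquiv F ε X).symm x) ((elementEquiv F ε Y).symm y)))
      (by simp [pureTensor_add_left])) (fun y y' ↦ by
        ext x
        simp [pureTensor_add_right])
  obtain ⟨μ, hμ⟩ := hD.exists_tensor_hom b
  exact ⟨μ, fun x y ↦ by simp [hμ, b]⟩

omit [MonoidalClosed D] in
include hC in
lemma exists_tensorComparison_inv (X Y : C) : ∃ ν : F.obj (X ⊗ Y) ⟶ F.obj X ⊗ F.obj Y,
    ∀ x y, elementEquiv F ε _ (pureTensor x y) ≫ ν =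
      pureTensor (elementEquiv F ε X x) (elementEquiv F ε Y y) := by
  -- The universal property of `X ⊗ Y` concerns targets in `C`, so the target is replaced by a
  -- preimage under `F`.
  let i := F.objObjPreimageIso (F.obj X ⊗ F.obj Y)
  let b : (𝟙_ C ⟶ Y) →+ (𝟙_ C ⟶ X) →+ (𝟙_ C ⟶ F.objPreimage (F.obj X ⊗ F.obj Y)) :=
    AddMonoidHom.mk' (fun y ↦ AddMonoidHom.mk' (fun x ↦ (elementEquiv F ε _).symm
      (pureTensor (elementEquiv F ε X x) (elementEquiv F ε Y y) ≫ i.inv))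
      (by simp [pureTensor_add_left])) (fun y y' ↦ by
        ext x
        simp [pureTensor_add_right])
  obtain ⟨k, hk⟩ := hC.exists_tensor_hom b
  refine ⟨F.map k ≫ i.hom, fun x y ↦ ?_⟩
  rw [← Category.assoc, elementEquiv_comp_map, hk]
  simp [b]

/-- The comparison isomorphism `F X ⊗ F Y ≅ F (X ⊗ Y)`. -/
def tensorComparison (X Y : C) : F.obj X ⊗ F.obj Y ≅ F.obj (X ⊗ Y) where
  hom := (exists_tensorComparison F ε hD X Y).choose
  inv := (exists_tensorComparison_inv F ε hC X Y).choose
  hom_inv_id := by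
    refine hD.tensor_hom_ext fun x y ↦ ?_
    obtain ⟨x, rfl⟩ := (elementEquiv F ε X).surjective x
    obtain ⟨y, rfl⟩ := (elementEquiv F ε Y).surjective y
    rw [← Category.assoc, (exists_tensorComparison F ε hD X Y).choose_spec,
      (exists_tensorComparison_inv F ε hC X Y).choose_spec, Category.comp_id]
  inv_hom_id := by
    -- Fullness moves the equation to `C`, where pure tensors detect maps out of `X ⊗ Y`.
    apply F.map_preimage _ |>.symm.trans
    refine (congrArg F.map (hC.tensor_hom_ext (g := 𝟙 _) fun x y ↦ ?_)).trans (F.map_id _)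
    apply (elementEquiv F ε _).injective
    rw [← elementEquiv_comp_map, F.map_preimage, ← Category.assoc,
      (exists_tensorComparison_inv F ε hC X Y).choose_spec,
      (exists_tensorComparison F ε hD X Y).choose_spec, Category.comp_id]

lemma pureTensor_comp_tensorComparison {X Y : C} (x : 𝟙_ C ⟶ X) (y : 𝟙_ C ⟶ Y) :
    pureTensor (elementEquiv F ε X x) (elementEquiv F ε Y y) ≫
      (tensorComparison F ε hC hD X Y).hom = elementEquiv F ε _ (pureTensor x y) :=
  (exists_tensorComparison F ε hD X Y).choose_spec x y

/-- An additive equivalence which preserves the units is strong monoidal if the units are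
additively dense. -/
def coreMonoidalOfUnitIso : F.CoreMonoidal where
  εIso := ε
  μIso := tensorComparison F ε hC hD
  μIso_hom_natural_left {X Y} f X' := by
    refine hD.tensor_hom_ext fun x y ↦ ?_
    obtain ⟨x, rfl⟩ := (elementEquiv F ε _).surjective x
    obtain ⟨y, rfl⟩ := (elementEquiv F ε _).surjective y
    rw [← Category.assoc, ← Category.assoc, pureTensor_comp_whiskerRight, elementEquiv_comp_map,
      pureTensor_comp_tensorComparison, pureTensor_comp_tensorComparison, elementEquiv_comp_map,
      pureTensor_comp_whiskerRight]
  μIso_hom_natural_right {X Y} X' f := by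
    refine hD.tensor_hom_ext fun x y ↦ ?_
    obtain ⟨x, rfl⟩ := (elementEquiv F ε _).surjective x
    obtain ⟨y, rfl⟩ := (elementEquiv F ε _).surjective y
    rw [← Category.assoc, ← Category.assoc, pureTensor_comp_whiskerLeft, elementEquiv_comp_map,
      pureTensor_comp_tensorComparison, pureTensor_comp_tensorComparison, elementEquiv_comp_map,
      pureTensor_comp_whiskerLeft]
  associativity X Y Z := by
    refine hD.tensor_hom_ext₃ fun x y z ↦ ?_
    obtain ⟨x, rfl⟩ := (elementEquiv F ε _).surjective x
    obtain ⟨y, rfl⟩ := (elementEquiv F ε _).surjective y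
    obtain ⟨z, rfl⟩ := (elementEquiv F ε _).surjective z
    rw [← Category.assoc, ← Category.assoc, ← Category.assoc, ← Category.assoc,
      pureTensor_comp_whiskerRight, pureTensor_comp_tensorComparison,
      pureTensor_comp_tensorComparison, elementEquiv_comp_map, pureTensor_comp_associator,
      pureTensor_comp_associator, pureTensor_comp_whiskerLeft, pureTensor_comp_tensorComparison,
      pureTensor_comp_tensorComparison]
  left_unitality X := by
    refine hD.tensor_hom_ext fun a x ↦ ?_
    obtain ⟨x, rfl⟩ := (elementEquiv F ε _).surjective x
    obtain ⟨a', ha'⟩ := (elementEquiv F ε _).surjective (a ≫ ε.hom)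
    rw [← Category.assoc, ← Category.assoc, pureTensor_comp_leftUnitor,
      pureTensor_comp_whiskerRight, ← ha', pureTensor_comp_tensorComparison,
      elementEquiv_comp_map, pureTensor_comp_leftUnitor, ← elementEquiv_comp_map, ha']
    simp [elementEquiv]
  right_unitality X := by
    refine hD.tensor_hom_ext fun x a ↦ ?_
    obtain ⟨x, rfl⟩ := (elementEquiv F ε _).surjective x
    obtain ⟨a', ha'⟩ := (elementEquiv F ε _).surjective (a ≫ ε.hom)
    rw [← Category.assoc, ← Category.assoc, pureTensor_comp_rightUnitor,
      pureTensor_comp_whiskerLeft, ← ha', pureTensor_comp_tensorComparison,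
      elementEquiv_comp_map, pureTensor_comp_rightUnitor, ← elementEquiv_comp_map, ha']
    simp [elementEquiv]

/-- An additive equivalence which preserves the units is strong symmetric monoidal if the units
are additively dense. -/
@[reducible]
def braidedOfUnitIso [BraidedCategory C] [BraidedCategory D] : F.Braided where
  toMonoidal := (coreMonoidalOfUnitIso F ε hC hD).toMonoidal
  braided X Y := by
    change (tensorComparison F ε hC hD X Y).hom ≫ _ = _ ≫ (tensorComparison F ε hC hD Y X).hom
    refine hD.tensor_hom_ext fun x y ↦ ?_
    obtain ⟨x, rfl⟩ := (elementEquiv F ε _).surjective x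
    obtain ⟨y, rfl⟩ := (elementEquiv F ε _).surjective y
    rw [← Category.assoc, ← Category.assoc, pureTensor_comp_tensorComparison,
      elementEquiv_comp_map, pureTensor_comp_braiding, pureTensor_comp_braiding,
      pureTensor_comp_tensorComparison]

end Compare

/-! ### Modules over a quotient of `ℤ` -/

section Modules

open TensorProduct

variable {R : Type*} [CommRing R]

/-- Additive maps between modules over a quotient of `ℤ` are linear. -/
def AddMonoidHom.toLinearMapOfSurjective (hR : Function.Surjective (Int.cast : ℤ → R))
    {M N : Type*} [AddCommGroup M] [AddCommGroup N] [Module R M] [Module R N] (f : M →+ N) :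
    M →ₗ[R] N where
  __ := f
  map_smul' r m := by
    obtain ⟨k, rfl⟩ := hR r
    exact map_intCast_smul f R R k m

end Modules

section ModuleCat

open TensorProduct

variable {R : Type} [CommRing R]

variable (R) in
/-- The free module of rank one. -/
abbrev rankOne : ModuleCat.{u} R := ModuleCat.of R (ULift.{u} R)

/-- The morphism from the free module of rank one which corresponds to an element. -/
def elementHom {X : ModuleCat.{u} R} (x : X) : rankOne.{u} R ⟶ X :=
  ModuleCat.ofHom ((LinearMap.toSpanSingleton R X x).comp ULift.moduleEquiv.toLinearMap)

@[simp]
lemma elementHom_one {X : ModuleCat.{u} R} (x : X) : elementHom x (ULift.up 1) = x := by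
  simp [elementHom]

lemma elementHom_comp_apply_one {X Y : ModuleCat.{u} R} (x : X) (f : X ⟶ Y) :
    (elementHom x ≫ f) (ULift.up 1) = f x :=
  congrArg f (elementHom_one x)

lemma elementHom_add {X : ModuleCat.{u} R} (x x' : X) :
    elementHom (x + x') = elementHom x + elementHom x' := by
  ext
  simp [elementHom]

lemma rankOne_hom_ext {X : ModuleCat.{u} R} {f g : rankOne.{u} R ⟶ X}
    (h : f (ULift.up 1) = g (ULift.up 1)) : f = g := by
  ext r
  obtain ⟨r⟩ := r
  have hr : (ULift.up r : ULift.{u} R) = r • ULift.up 1 := by ext; simp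
  change f (ULift.up r) = g (ULift.up r)
  rw [hr, map_smul, map_smul, h]

lemma isAdditivelyDense_of_iso_rankOne (hR : Function.Surjective (Int.cast : ℤ → R))
    {U : ModuleCat.{u} R} (e : U ≅ rankOne.{u} R) : IsAdditivelyDense U where
  hom_ext {X Y f g} h := by
    ext x
    have := congr(e.inv ≫ $(h (e.hom ≫ elementHom x)))
    simp only [Category.assoc, Iso.inv_hom_id_assoc] at this
    exact (elementHom_comp_apply_one x f).symm.trans
      (congr($this (ULift.up 1)).trans (elementHom_comp_apply_one x g))
  exists_hom {X Y} φ := by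
    let f : X →+ Y := AddMonoidHom.mk'
      (fun x ↦ (e.inv ≫ φ (e.hom ≫ elementHom x)) (ULift.up 1)) (by simp [elementHom_add])
    refine ⟨ModuleCat.ofHom (f.toLinearMapOfSurjective hR), fun x ↦ ?_⟩
    rw [← cancel_epi e.inv]
    refine rankOne_hom_ext ?_
    have : elementHom ((e.inv ≫ x) (ULift.up 1)) = e.inv ≫ x :=
      rankOne_hom_ext (elementHom_one _)
    change (e.inv ≫ φ (e.hom ≫ elementHom ((e.inv ≫ x) (ULift.up 1)))) (ULift.up 1) = _
    rw [this, Iso.hom_inv_id_assoc]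

section EilenbergWatts

variable (hR : Function.Surjective (Int.cast : ℤ → R))
  {G H : ModuleCat.{u} R ⥤ ModuleCat.{u} R} [G.Additive] (adj : G ⊣ H)

variable (G) in
/-- The canonical map `X ⊗ G R → G X`. -/
def tensorToFunctor (X : ModuleCat.{u} R) :
    X ⊗[R] G.obj (rankOne.{u} R) →ₗ[R] G.obj X :=
  TensorProduct.lift (AddMonoidHom.toLinearMapOfSurjective hR
    (AddMonoidHom.mk' (fun x ↦ (G.map (elementHom x)).hom) fun x x' ↦ by
      rw [elementHom_add, G.map_add, ModuleCat.hom_add]))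

lemma tensorToFunctor_tmul (X : ModuleCat.{u} R) (x : X) (y : G.obj (rankOne.{u} R)) :
    tensorToFunctor hR G X (x ⊗ₜ y) = G.map (elementHom x) y := rfl

include hR adj in
/-- The Eilenberg–Watts isomorphism for a left adjoint functor. -/
lemma exists_tensor_linearEquiv (X : ModuleCat.{u} R) :
    Nonempty ((X ⊗[R] G.obj (rankOne.{u} R)) ≃ₗ[R] G.obj X) := by
  have : H.Additive := adj.right_adjoint_additive
  let T : ModuleCat.{u} R := ModuleCat.of R (X ⊗[R] G.obj (rankOne.{u} R))
  let t (x : X) : G.obj (rankOne.{u} R) ⟶ T := ModuleCat.ofHom (TensorProduct.mk R _ _ x)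
  -- The transpose of `t x` is a map from the free module of rank one to `H T`, hence an element of
  -- `H T`. The transpose of `γ` is the inverse of the canonical map, so exactness of `G` need not
  -- be invoked.
  let γ : X ⟶ H.obj T := ModuleCat.ofHom (AddMonoidHom.toLinearMapOfSurjective hR
    (AddMonoidHom.mk' (fun x ↦ adj.homEquiv _ _ (t x) (ULift.up 1)) fun x x' ↦ by
      have : t (x + x') = t x + t x' := by ext; simp [t]
      rw [this, adj.homEquiv_unit, adj.homEquiv_unit, adj.homEquiv_unit]
      simp))
  have hγ (x : X) : elementHom x ≫ γ = adj.homEquiv _ _ (t x) :=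
    rankOne_hom_ext (by
      rw [ModuleCat.comp_apply, elementHom_one]
      rfl)
  let β : G.obj X ⟶ T := (adj.homEquiv _ _).symm γ
  let α : T ⟶ G.obj X := ModuleCat.ofHom (tensorToFunctor hR G X)
  have htα (x : X) : t x ≫ α = G.map (elementHom x) := by
    ext y
    exact tensorToFunctor_tmul hR X x y
  have h₁ : β ≫ α = 𝟙 _ := by
    apply (adj.homEquiv _ _).injective
    rw [adj.homEquiv_naturality_right, Equiv.apply_symm_apply]
    ext x
    have := congr($(hγ x) ≫ H.map α)
    rw [← adj.homEquiv_naturality_right, htα, ← Category.comp_id (G.map _),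
      adj.homEquiv_naturality_left, Category.assoc] at this
    exact (elementHom_comp_apply_one x (γ ≫ H.map α)).symm.trans
      (congr($this (ULift.up 1)).trans (elementHom_comp_apply_one x _))
  have h₂ : α ≫ β = 𝟙 _ := by
    apply ModuleCat.hom_ext
    refine TensorProduct.ext' fun x y ↦ ?_
    have : G.map (elementHom x) ≫ β = t x := by
      rw [← adj.homEquiv_naturality_left_symm, hγ, Equiv.symm_apply_apply]
    exact congr($this y)
  exact ⟨(Iso.mk α β h₂ h₁).toLinearEquiv⟩

end EilenbergWatts

/-- The unit of an additive closed symmetric monoidal structure on the category of modules is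
free of rank one. -/
lemma nonempty_unit_iso_rankOne (hR : Function.Surjective (Int.cast : ℤ → R))
    [Subsingleton (CommRing.Pic R)]
    [MonoidalCategory (ModuleCat.{u} R)] [MonoidalPreadditive (ModuleCat.{u} R)]
    [MonoidalClosed (ModuleCat.{u} R)] :
    Nonempty (𝟙_ (ModuleCat.{u} R) ≅ rankOne.{u} R) := by
  let A := rankOne.{u} R
  -- Evaluating `A ⊗ -` at the unit gives `A` by the right unitor, so the unit is a tensor factor of
  -- `R`.
  obtain ⟨e⟩ := exists_tensor_linearEquiv hR (ihom.adjunction A) (𝟙_ (ModuleCat.{u} R))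
  let e' := e ≪≫ₗ (ρ_ A).toLinearEquiv ≪≫ₗ ULift.moduleEquiv
  have : Module.Invertible R (𝟙_ (ModuleCat.{u} R) : ModuleCat.{u} R) := .left e'
  obtain ⟨f⟩ := Module.Invertible.free_iff_linearEquiv.mp
    (inferInstance : Module.Free R (𝟙_ (ModuleCat.{u} R) : ModuleCat.{u} R))
  exact ⟨(f ≪≫ₗ ULift.moduleEquiv.symm).toModuleIso⟩

lemma AdditiveClosedSymmetricMonoidalStructure.equivalent_of_surjective_intCast
    (hR : Function.Surjective (Int.cast : ℤ → R)) [Subsingleton (CommRing.Pic R)]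
    (S T : AdditiveClosedSymmetricMonoidalStructure (ModuleCat.{u} R)) : S.Equivalent T := by
  obtain ⟨eS⟩ := @nonempty_unit_iso_rankOne R _ hR _ S.monoidal S.additive S.closed
  obtain ⟨eT⟩ := @nonempty_unit_iso_rankOne R _ hR _ T.monoidal T.additive T.closed
  exact ⟨𝟭 _, inferInstance, inferInstance,
    ⟨@braidedOfUnitIso _ _ _ _ S.monoidal _ _ T.monoidal (𝟭 _) _ _ (eT ≪≫ eS.symm)
      S.additive S.closed T.additive T.closed (isAdditivelyDense_of_iso_rankOne hR eS)
      (isAdditivelyDense_of_iso_rankOne hR eT) S.symmetric.toBraidedCategory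
      T.symmetric.toBraidedCategory⟩⟩

end ModuleCat

/-! ### Existence, and the Picard group of the base ring -/

/-- Additive closed symmetric monoidal structures are transported along equivalences. -/
def AdditiveClosedSymmetricMonoidalStructure.transport {C D : Type*} [Category* C] [Category* D]
    [Preadditive C] [Preadditive D] [MonoidalCategory C] [SymmetricCategory C]
    [MonoidalPreadditive C] [MonoidalClosed C] (e : C ≌ D) [e.inverse.Additive] :
    AdditiveClosedSymmetricMonoidalStructure D :=
  letI : Preadditive (Monoidal.Transported e) := inferInstanceAs (Preadditive D)
  letI F := (Monoidal.equivalenceTransported e).inverse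
  haveI : F.Additive := ⟨fun {_ _ f g} ↦ e.inverse.map_add (f := f) (g := g)⟩
  letI S : AdditiveClosedSymmetricMonoidalStructure (Monoidal.Transported e) :=
    { monoidal := inferInstance
      symmetric := SymmetricCategory.ofFaithful F
      additive := monoidalPreadditive_of_faithful F
      closed := inferInstance }
  S

/-- The ring is the principal ideal domain `ℤ` for `n = 0`, and otherwise finite, hence semilocal.
-/
lemma subsingleton_pic_quotient_span_int (n : ℤ) :
    Subsingleton (CommRing.Pic (ℤ ⧸ Ideal.span ({n} : Set ℤ))) := by
  by_cases hn : n = 0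
  · subst hn
    let e : ℤ ≃+* ℤ ⧸ Ideal.span ({0} : Set ℤ) :=
      ((Ideal.quotEquivOfEq (by simp)).trans (RingEquiv.quotientBot ℤ)).symm
    have : IsDomain (ℤ ⧸ Ideal.span ({0} : Set ℤ)) := e.symm.toMulEquiv.isDomain
    have : IsPrincipalIdealRing (ℤ ⧸ Ideal.span ({0} : Set ℤ)) :=
      .of_surjective e e.surjective
    infer_instance
  · have : Finite (ℤ ⧸ Ideal.span ({n} : Set ℤ)) := by
      have : NeZero n.natAbs := ⟨by simpa using hn⟩
      exact .of_equiv _ (Int.quotientSpanEquivZMod n).symm.toEquiv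
    infer_instance

end

theorem theorem3p2 (n : ℤ) :
    Nonempty (AdditiveClosedSymmetricMonoidalStructure
      (ModuleCat.{u} (ℤ ⧸ Ideal.span ({n} : Set ℤ)))) ∧
    ∀ S T : AdditiveClosedSymmetricMonoidalStructure
      (ModuleCat.{u} (ℤ ⧸ Ideal.span ({n} : Set ℤ))), S.Equivalent T := by
  let R := ℤ ⧸ Ideal.span ({n} : Set ℤ)
  -- Lifting `R` to the universe of the modules gives access to the usual tensor product, which is
  -- then transported.
  let e : ModuleCat.{u} (ULift.{u} R) ≌ ModuleCat.{u} R :=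
    ModuleCat.restrictScalarsEquivalenceOfRingEquiv ULift.ringEquiv.symm
  have : e.inverse.Additive := ⟨rfl⟩
  refine ⟨⟨.transport e⟩, ?_⟩
  have := subsingleton_pic_quotient_span_int n
  refine AdditiveClosedSymmetricMonoidalStructure.equivalent_of_surjective_intCast fun r ↦ ?_
  obtain ⟨k, rfl⟩ := Ideal.Quotient.mk_surjective r
  exact ⟨k, by simp⟩
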